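/- Let $x$ be a random vector in $\mathbb{R}^p$ and $y,\hat y$ random vectors in $\mathbb{R}^n$, such that $(x,y)$ and $(x,\hat y)$ are each jointly Gaussian. Let $m_u=\mathbb{E}[u]$ and $C_{uv}=\mathbb{E}[(u-m_u)(v-m_v)^T]$ denote means and (cross-)covariance matrices, assume that $C_{xx}$ is invertible, and for $u\in\{y,\hat y\}$ put $$m_{u|x}=m_u+C_{ux}C_{xx}^{-1}(x-m_x),\qquad C_{uu|x}=C_{uu}-C_{ux}C_{xx}^{-1}C_{xu}.$$ For probability measures $\mu,\nu$ on $\mathbb{R}^n$ let $\mathcal{W}(\mu;\nu)$ be the infimum of $\mathbb{E}\|u-v\|^2$ over all joint laws of $(u,v)$ with $u\sim\mu$, $v\sim\nu$ (the quadratic Wasserstein distance, without square root), and define $$\mathrm{CFID}=\mathbb{E}_x\left[\mathcal{W}(\mathbb{Q}_{y|x};\mathbb{Q}_{\hat y|x})\right],$$ where $\mathbb{Q}_{u|x}$ is the conditional law of $u$ given $x$. Write $A^{1/2}$ for the positive semidefinite square root of a positive semidefinite matrix $A$. Then $C_{yy|x}$ and $C_{\hat y\hat y|x}$ are positive semidefinite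 and, for almost every $x$, $\mathbb{Q}_{y|x}=\mathcal{N}(m_{y|x},C_{yy|x})$, $\mathbb{Q}_{\hat y|x}=\mathcal{N}(m_{\hat y|x},C_{\hat y\hat y|x})$, and the infimum $\mathcal{W}(\mathbb{Q}_{y|x};\mathbb{Q}_{\hat y|x})$ is attained and equals the Fréchet distance $$\|m_{y|x}-m_{\hat y|x}\|^2+\mathrm{Tr}\left[C_{yy|x}+C_{\hat y\hat y|x}-2\left(C_{yy|x}^{1/2}C_{\hat y\hat y|x}C_{yy|x}^{1/2}\right)^{1/2}\right].$$ Moreover $\mathrm{CFID}$ is finite, this Fréchet distance is integrable in $x$, and $$\begin{aligned}\mathrm{CFID}&=\mathbb{E}_x\left[\|m_{y|x}-m_{\hat y|x}\|^2+\mathrm{Tr}\left[C_{yy|x}+C_{\hat y\hat y|x}-2\left(C_{yy|x}^{1/2}C_{\hat y\hat y|x}C_{yy|x}^{1/2}\right)^{1/2}\right]\right]\\&=\|m_y-m_{\hat y}\|^2+\mathrm{Tr}\left[(C_{yx}-C_{\hat yx})C_{xx}^{-1}(C_{xy}-C_{x\hat y})\right]+\mathrm{Tr}\left[C_{yy|x}+C_{\hat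 y\hat y|x}-2\left(C_{yy|x}^{1/2}C_{\hat y\hat y|x}C_{yy|x}^{1/2}\right)^{1/2}\right].\end{aligned}$$ In particular, $\mathrm{CFID}$ depends only on first and second moments: two such models with the same $m_y,m_{\hat y},C_{xx},C_{yx},C_{\hat yx},C_{yy},C_{\hat y\hat y}$ have the same $\mathrm{CFID}$. -/

import Mathlib

open MeasureTheory ProbabilityTheory
open scoped ENNReal MatrixOrder Matrix

noncomputable section

/-- The set of transport costs `𝔼 ‖y - y'‖²` over all joint laws `π` of `(y, y')` with
prescribed marginals `μ` and `ν`. -/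
def transportCosts {E : Type*} [NormedAddCommGroup E] [MeasurableSpace E]
    (μ ν : Measure E) : Set ℝ≥0∞ :=
  {c | ∃ π : Measure (E × E), π.map Prod.fst = μ ∧ π.map Prod.snd = ν ∧
    c = ∫⁻ q, ‖q.1 - q.2‖ₑ ^ 2 ∂π}

/-- The Wasserstein distance with quadratic cost (not square-rooted):
the least transport cost. -/
def wassersteinDist {E : Type*} [NormedAddCommGroup E] [MeasurableSpace E]
    (μ ν : Measure E) : ℝ≥0∞ :=
  sInf (transportCosts μ ν)

/-- The conditional Wasserstein distance of `Y` and `Yh` given `X`: the expectation over `x ∼ X`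
of the Wasserstein distance between the conditional laws of `Y` and of `Yh` given `X = x`.
For jointly Gaussian variables this is the conditional Fréchet (inception) distance. -/
def cfid {Ω F E : Type*} [MeasurableSpace Ω] [MeasurableSpace F]
    [NormedAddCommGroup E] [MeasurableSpace E] [StandardBorelSpace E]
    (P : Measure Ω) [IsFiniteMeasure P] (X : Ω → F) (Y Yh : Ω → E) : ℝ≥0∞ :=
  ∫⁻ x, wassersteinDist (condDistrib Y X P x) (condDistrib Yh X P x) ∂(P.map X)

/-- The (cross-)covariance matrix `C_{uv} = 𝔼[(u - m_u)(v - m_v)ᵀ]` of two random vectors. -/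
def crossCov {Ω k l : Type*} [MeasurableSpace Ω] (P : Measure Ω)
    (U : Ω → EuclideanSpace ℝ k) (V : Ω → EuclideanSpace ℝ l) : Matrix k l ℝ :=
  Matrix.of fun i j => covariance (fun ω => U ω i) (fun ω => V ω j) P

/-- The conditional mean `m_{y|x} = m_y + C_{yx} C_{xx}⁻¹ (x - m_x)`. -/
def condMean {Ω p n : Type*} [Fintype p] [DecidableEq p] [Fintype n] [MeasurableSpace Ω]
    (P : Measure Ω) (X : Ω → EuclideanSpace ℝ p) (Y : Ω → EuclideanSpace ℝ n)
    (x : EuclideanSpace ℝ p) : EuclideanSpace ℝ n :=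
  (∫ ω, Y ω ∂P) +
    WithLp.toLp 2 ((crossCov P Y X * (crossCov P X X)⁻¹) *ᵥ (x - ∫ ω, X ω ∂P).ofLp)

/-- The conditional covariance `C_{yy|x} = C_{yy} - C_{yx} C_{xx}⁻¹ C_{xy}`. -/
def condCov {Ω p n : Type*} [Fintype p] [DecidableEq p] [MeasurableSpace Ω]
    (P : Measure Ω) (X : Ω → EuclideanSpace ℝ p) (Y : Ω → EuclideanSpace ℝ n) :
    Matrix n n ℝ :=
  crossCov P Y Y - crossCov P Y X * (crossCov P X X)⁻¹ * crossCov P X Y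

/-- The trace term `Tr(C₁ + C₂ - 2 (C₁^{1/2} C₂ C₁^{1/2})^{1/2})`; `CFC.sqrt` is the
positive semidefinite square root of a positive semidefinite matrix. -/
def covTerm {n : Type*} [Fintype n] [DecidableEq n] (C₁ C₂ : Matrix n n ℝ) : ℝ :=
  (C₁ + C₂ - 2 • CFC.sqrt (CFC.sqrt C₁ * C₂ * CFC.sqrt C₁)).trace

end

/-! Conditioning. The residual `R = Y - C_yx C_xx⁻¹ X` is uncorrelated with `X`, hence independent
of it by joint Gaussianity. So given `X = x` the law of `Y` is that of `R` translated by `C_yx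
C_xx⁻¹ x`: a Gaussian whose mean is affine in `x` and whose covariance `condCov` does not depend on
`x`.

Transport between Gaussians `N(a, A)` and `N(b, B)`. The cost of a coupling depends on it only
through the trace of the cross-covariance `K`, so the task is to maximise `tr K`. With `S =
A^{1/2}`, `T = B^{1/2}` and `M = (S B S)^{1/2}`, the upper bound `tr K ≤ tr M` comes from `𝔼‖P u - Q
v‖² ≥ 0` (after centring) for well-chosen matrices `P`, `Q` (`Matrix.trace_le_trace_sqrt`). Equality
is reached by driving both vectors with one standard Gaussian `z`, namely `a + S z` and `b + T U z`,
where `T S = U M` is a polar decomposition (`exists_optimal_gaussian_coupling`). Neither half needs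
`A` or `B` to be invertible.

Averaging over `x`. The trace term is constant, and the difference of the conditional means is
affine in `X`, so its second moment is its squared mean plus the trace of its covariance
(`integral_norm_condMean_sub_condMean_sq`). -/

/-- Two linear maps with the same pointwise norms differ by a linear isometry. -/
lemma LinearMap.exists_linearIsometry_comp_eq {V W : Type*} [NormedAddCommGroup V]
    [InnerProductSpace ℝ V] [FiniteDimensional ℝ V] [AddCommGroup W] [Module ℝ W]
    (f g : W →ₗ[ℝ] V) (h : ∀ x, ‖f x‖ = ‖g x‖) :
    ∃ u : V →ₗᵢ[ℝ] V, ∀ x, u (f x) = g x := by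
  obtain ⟨s, hs⟩ := f.rangeRestrict.exists_rightInverse_of_surjective f.range_rangeRestrict
  have hs' (y : LinearMap.range f) : f (s y) = y := congrArg Subtype.val (LinearMap.congr_fun hs y)
  let L : LinearMap.range f →ₗᵢ[ℝ] V := ⟨g ∘ₗ s, fun y => by
    rw [LinearMap.comp_apply, ← h, hs']; rfl⟩
  refine ⟨L.extend, fun x => ?_⟩
  have h1 : L.extend (f x) = L ⟨f x, x, rfl⟩ := L.extend_apply ⟨f x, x, rfl⟩
  -- Equal norms force equal kernels, so `g` does not see which preimage of `f x` the section `s`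
  -- picks.
  have h2 : ‖g (s ⟨f x, x, rfl⟩ - x)‖ = 0 := by rw [← h, map_sub, hs', sub_self, norm_zero]
  rw [norm_eq_zero, map_sub, sub_eq_zero] at h2
  rw [h1]
  exact h2

/-! ### Square roots, polar decomposition and the trace bound -/

namespace Matrix

lemma PosSemidef.transpose_eq {n : Type*} {A : Matrix n n ℝ} (hA : A.PosSemidef) : Aᵀ = A := by
  simpa using hA.isHermitian.eq

lemma PosSemidef.trace_mul_mul_transpose_nonneg {n : Type*} [Fintype n] {A : Matrix n n ℝ}
    (hA : A.PosSemidef) (P : Matrix n n ℝ) : 0 ≤ (P * A * Pᵀ).trace := by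
  simpa using (hA.mul_mul_conjTranspose_same P).trace_nonneg

variable {n : Type*} [Fintype n] [DecidableEq n]

lemma posSemidef_sqrt (A : Matrix n n ℝ) : (CFC.sqrt A).PosSemidef :=
  nonneg_iff_posSemidef.1 (CFC.sqrt_nonneg A)

lemma transpose_sqrt (A : Matrix n n ℝ) : (CFC.sqrt A)ᵀ = CFC.sqrt A :=
  (posSemidef_sqrt A).transpose_eq

lemma norm_sq_toEuclideanCLM_apply (N : Matrix n n ℝ) (x : EuclideanSpace ℝ n) :
    ‖toEuclideanCLM (𝕜 := ℝ) N x‖ ^ 2 = x.ofLp ⬝ᵥ (Nᵀ * N) *ᵥ x.ofLp := by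
  rw [EuclideanSpace.real_norm_sq_eq, ofLp_toEuclideanCLM, ← mulVec_mulVec,
    dotProduct_mulVec, vecMul_transpose]
  simp [dotProduct, sq]

/-- Polar decomposition of a real square matrix. -/
lemma exists_linearIsometry_polar (N : Matrix n n ℝ) :
    ∃ u : EuclideanSpace ℝ n →ₗᵢ[ℝ] EuclideanSpace ℝ n, ∀ x,
      u (toEuclideanCLM (𝕜 := ℝ) (CFC.sqrt (Nᵀ * N)) x) = toEuclideanCLM (𝕜 := ℝ) N x := by
  refine LinearMap.exists_linearIsometry_comp_eq
    (toEuclideanCLM (𝕜 := ℝ) (CFC.sqrt (Nᵀ * N))).toLinearMap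
    (toEuclideanCLM (𝕜 := ℝ) N).toLinearMap fun x => ?_
  have hN : (0 : Matrix n n ℝ) ≤ Nᵀ * N := by
    simpa using (posSemidef_conjTranspose_mul_self N).nonneg
  -- Both squared norms are the quadratic form of `Nᵀ * N` at `x`.
  rw [← sq_eq_sq₀ (norm_nonneg _) (norm_nonneg _)]
  simp only [ContinuousLinearMap.coe_coe]
  rw [norm_sq_toEuclideanCLM_apply, norm_sq_toEuclideanCLM_apply, transpose_sqrt,
    CFC.sqrt_mul_sqrt_self _ hN]

/-- Polar decomposition of a real square matrix, in matrix form. -/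
lemma exists_orthogonal_mul_sqrt (N : Matrix n n ℝ) :
    ∃ U : Matrix n n ℝ, Uᵀ * U = 1 ∧ U * CFC.sqrt (Nᵀ * N) = N := by
  obtain ⟨u, hu⟩ := exists_linearIsometry_polar N
  obtain ⟨U, hU⟩ := EquivLike.surjective (toEuclideanCLM (n := n) (𝕜 := ℝ)) u.toContinuousLinearMap
  refine ⟨U, ?_, EquivLike.injective (toEuclideanCLM (n := n) (𝕜 := ℝ)) ?_⟩
  · have : star U * U = 1 := by
      apply EquivLike.injective (toEuclideanCLM (n := n) (𝕜 := ℝ))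
      rw [map_mul, map_star, map_one, hU]
      exact (ContinuousLinearMap.norm_map_iff_adjoint_comp_self u.toContinuousLinearMap).1
        u.norm_map
    simpa [star_eq_conjTranspose] using this
  · rw [map_mul, hU]
    ext1 x
    exact hu x

/-- The bound on the trace of a cross-covariance `K` of two vectors with covariances `A`, `B`:
the hypothesis says that the trace of the covariance of `P u - Q v` is nonnegative. -/
lemma trace_le_trace_sqrt {A B K : Matrix n n ℝ} (hA : A.PosSemidef) (hB : B.PosSemidef)
    (h : ∀ P Q : Matrix n n ℝ,
      2 * (P * K * Qᵀ).trace ≤ (P * A * Pᵀ).trace + (Q * B * Qᵀ).trace) :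
    K.trace ≤ (CFC.sqrt (CFC.sqrt A * B * CFC.sqrt A)).trace := by
  set S := CFC.sqrt A with hS
  have hSp : S.PosSemidef := posSemidef_sqrt A
  have hSt : Sᵀ = S := hSp.transpose_eq
  have hSS : S * S = A := CFC.sqrt_mul_sqrt_self A hA.nonneg
  have hSBS : (S * B * S).PosSemidef := by
    simpa [hSt] using hB.mul_mul_conjTranspose_same S
  set M := CFC.sqrt (S * B * S) with hM
  have hMp : M.PosSemidef := posSemidef_sqrt _
  have hMM : M * M = S * B * S := CFC.sqrt_mul_sqrt_self _ hSBS.nonneg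
  -- The shift by `ε` makes `M` invertible and the shift by `δ` makes `S` invertible. The constants
  -- may depend on `ε` but not on `δ`, so `δ → 0` is taken first and `ε → 0` afterwards.
  have key (ε : ℝ) (hε : 0 < ε) : ∃ c₁ c₂ : ℝ, ∀ δ > 0,
      2 * K.trace ≤ 2 * (M.trace + ε * Fintype.card n) + (δ * c₁ + δ ^ 2 * c₂) := by
    set Me := M + ε • (1 : Matrix n n ℝ) with hMe
    have hMep : Me.PosDef := (PosDef.one.smul hε).posSemidef_add hMp
    set H := CFC.sqrt Me with hH
    have hHt : Hᵀ = H := transpose_sqrt Me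
    have hHH : H * H = Me := CFC.sqrt_mul_sqrt_self _ hMep.posSemidef.nonneg
    have hHu : IsUnit H.det := by
      have : IsUnit Me.det := (isUnit_iff_isUnit_det _).1 hMep.isUnit
      rw [← hHH, det_mul] at this
      exact isUnit_of_mul_isUnit_left this
    have hMetr : Me.trace = M.trace + ε * Fintype.card n := by
      simp [hMe, trace_add, trace_smul, trace_one]
    -- The coefficients of `δ` and `δ ^ 2` in the trace of `H⁻¹ (S + δ) B (S + δ) H⁻¹`.
    refine ⟨(H⁻¹ * (S * B + B * S) * H⁻¹).trace, (H⁻¹ * B * H⁻¹).trace, fun δ hδ => ?_⟩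
    set Sd := S + δ • (1 : Matrix n n ℝ) with hSd
    have hSdp : Sd.PosDef := (PosDef.one.smul hδ).posSemidef_add hSp
    have hSdt : Sdᵀ = Sd := hSdp.posSemidef.transpose_eq
    have hSdu : IsUnit Sd.det := (isUnit_iff_isUnit_det _).1 hSdp.isUnit
    -- Here `Pᵀ P = Sd⁻¹ Me Sd⁻¹` is the regularised optimal transport map and `Qᵀ Q` its inverse.
    -- The factors cancel cyclically around `K`, while `P A Pᵀ` and `Q B Qᵀ` both become `M` in the
    -- formal limit.
    have h0 := h (H * Sd⁻¹) (H⁻¹ * Sd)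
    have hK : (H * Sd⁻¹ * K * (H⁻¹ * Sd)ᵀ).trace = K.trace := by
      rw [trace_mul_comm, transpose_mul, hSdt, transpose_nonsing_inv, hHt]
      congr 1
      simp only [← mul_assoc]
      rw [mul_assoc Sd, nonsing_inv_mul _ hHu, mul_one, mul_nonsing_inv _ hSdu, one_mul]
    -- Replacing `A` by the larger `Sd * Sd` turns the product into exactly `H * H = Me`; below, `Me
    -- * Me` replaces `M * M` in the same way.
    have hAb : (H * Sd⁻¹ * A * (H * Sd⁻¹)ᵀ).trace ≤ Me.trace := by
      have hD : Sd * Sd - A = (2 * δ) • S + (δ ^ 2) • (1 : Matrix n n ℝ) := by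
        rw [hSd, ← hSS]
        simp only [add_mul, mul_add, smul_mul_assoc, mul_smul_comm, one_mul, mul_one]
        module
      have hDp : (Sd * Sd - A).PosSemidef := by
        rw [hD]
        exact (hSp.smul (by positivity)).add (PosSemidef.one.smul (by positivity))
      have h1 := hDp.trace_mul_mul_transpose_nonneg (H * Sd⁻¹)
      rw [mul_sub, sub_mul, trace_sub] at h1
      have h2 : H * Sd⁻¹ * (Sd * Sd) * (H * Sd⁻¹)ᵀ = Me := by
        rw [transpose_mul, transpose_nonsing_inv, hSdt, hHt]
        simp only [← mul_assoc]
        rw [mul_assoc H, nonsing_inv_mul _ hSdu, mul_one, mul_assoc H, mul_nonsing_inv _ hSdu,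
          mul_one, hHH]
      rw [h2] at h1
      linarith
    have hBb : (H⁻¹ * Sd * B * (H⁻¹ * Sd)ᵀ).trace ≤ Me.trace +
        (δ * (H⁻¹ * (S * B + B * S) * H⁻¹).trace + δ ^ 2 * (H⁻¹ * B * H⁻¹).trace) := by
      have h1 : H⁻¹ * Sd * B * (H⁻¹ * Sd)ᵀ = H⁻¹ * (M * M) * H⁻¹ +
          (δ • (H⁻¹ * (S * B + B * S) * H⁻¹) + δ ^ 2 • (H⁻¹ * B * H⁻¹)) := by
        rw [transpose_mul, transpose_nonsing_inv, hSdt, hHt, hMM, hSd]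
        simp only [add_mul, mul_add, smul_mul_assoc, mul_smul_comm, one_mul, mul_one, smul_add,
          mul_assoc]
        module
      have hD : Me * Me - M * M = (2 * ε) • M + (ε ^ 2) • (1 : Matrix n n ℝ) := by
        rw [hMe]
        simp only [add_mul, mul_add, smul_mul_assoc, mul_smul_comm, one_mul, mul_one]
        module
      have hDp : (Me * Me - M * M).PosSemidef := by
        rw [hD]
        exact (hMp.smul (by positivity)).add (PosSemidef.one.smul (by positivity))
      have h2 := hDp.trace_mul_mul_transpose_nonneg H⁻¹
      rw [transpose_nonsing_inv, hHt, mul_sub, sub_mul, trace_sub] at h2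
      have h3 : H⁻¹ * (Me * Me) * H⁻¹ = Me := by
        rw [← hHH]
        simp only [← mul_assoc]
        rw [nonsing_inv_mul _ hHu, one_mul, mul_assoc, mul_nonsing_inv _ hHu, mul_one]
      rw [h3] at h2
      rw [h1, trace_add, trace_add, trace_smul, trace_smul, smul_eq_mul, smul_eq_mul]
      linarith
    rw [hK] at h0
    linarith
  have key' (ε : ℝ) (hε : 0 < ε) : K.trace ≤ M.trace + ε * Fintype.card n := by
    obtain ⟨c₁, c₂, hc⟩ := key ε hε
    have hlim : Filter.Tendsto (fun δ : ℝ => 2 * (M.trace + ε * Fintype.card n) +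
        (δ * c₁ + δ ^ 2 * c₂)) (nhdsWithin 0 (Set.Ioi 0))
        (nhds (2 * (M.trace + ε * Fintype.card n) + (0 * c₁ + 0 ^ 2 * c₂))) :=
      (Continuous.tendsto (by fun_prop) _).mono_left nhdsWithin_le_nhds
    have := ge_of_tendsto hlim (by
      filter_upwards [self_mem_nhdsWithin] with δ hδ using hc δ hδ)
    linarith
  have hlim : Filter.Tendsto (fun ε : ℝ => M.trace + ε * Fintype.card n)
      (nhdsWithin 0 (Set.Ioi 0)) (nhds (M.trace + 0 * Fintype.card n)) :=
    (Continuous.tendsto (by fun_prop) _).mono_left nhdsWithin_le_nhds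
  have := ge_of_tendsto hlim (by
    filter_upwards [self_mem_nhdsWithin] with ε hε using key' ε hε)
  linarith

end Matrix

/-! ### Calculus of cross-covariance matrices -/

section CrossCov

variable {Ω : Type*} [MeasurableSpace Ω] {P : Measure Ω} {k l m : Type*}

lemma crossCov_transpose (U : Ω → EuclideanSpace ℝ k) (V : Ω → EuclideanSpace ℝ l) :
    (crossCov P U V)ᵀ = crossCov P V U := by
  ext i j
  exact covariance_comm _ _

variable {U U' : Ω → EuclideanSpace ℝ k} {V V' : Ω → EuclideanSpace ℝ l}

lemma crossCov_map {Ω' : Type*} [MeasurableSpace Ω'] {Q : Measure Ω'} {f : Ω' → Ω}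
    (hU : AEStronglyMeasurable U (Q.map f)) (hV : AEStronglyMeasurable V (Q.map f))
    (hf : AEMeasurable f Q) :
    crossCov (Q.map f) U V = crossCov Q (fun ω => U (f ω)) (fun ω => V (f ω)) := by
  ext i j
  exact covariance_map_fun ((EuclideanSpace.proj (𝕜 := ℝ) i).continuous.comp_aestronglyMeasurable hU)
    ((EuclideanSpace.proj (𝕜 := ℝ) j).continuous.comp_aestronglyMeasurable hV) hf

variable [Fintype k] [Fintype l]

lemma MeasureTheory.MemLp.toLp_mulVec (hU : MemLp U 2 P)
    [Fintype m] (D : Matrix m k ℝ) : MemLp (fun ω => WithLp.toLp 2 (D *ᵥ (U ω).ofLp)) 2 P := by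
  classical
  exact (Matrix.toLpLin 2 2 D).toContinuousLinearMap.comp_memLp' hU

lemma integral_toLp_mulVec (hU : Integrable U P)
    [Fintype m] (D : Matrix m k ℝ) :
    ∫ ω, (WithLp.toLp 2 (D *ᵥ (U ω).ofLp) : EuclideanSpace ℝ m) ∂P
      = WithLp.toLp 2 (D *ᵥ (∫ ω, U ω ∂P).ofLp) := by
  classical
  exact (Matrix.toLpLin 2 2 D).toContinuousLinearMap.integral_comp_comm hU

lemma lintegral_enorm_sq_eq (hU : MemLp U 2 P) :
    ∫⁻ ω, ‖U ω‖ₑ ^ 2 ∂P = ENNReal.ofReal (∫ ω, ‖U ω‖ ^ 2 ∂P) := by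
  rw [ofReal_integral_eq_lintegral_ofReal (hU.integrable_norm_pow two_ne_zero)
    (Filter.Eventually.of_forall fun ω => sq_nonneg _)]
  simp_rw [ENNReal.ofReal_pow (norm_nonneg _), ofReal_norm]

variable [IsProbabilityMeasure P]

lemma crossCov_mulVec_left (hU : MemLp U 2 P) (hV : MemLp V 2 P) (D : Matrix m k ℝ) :
    crossCov P (fun ω => WithLp.toLp 2 (D *ᵥ (U ω).ofLp)) V = D * crossCov P U V := by
  ext i j
  simp only [crossCov, Matrix.of_apply, Matrix.mul_apply, Matrix.mulVec, dotProduct]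
  rw [covariance_fun_sum_left (fun a => (memLp_piLp_iff.1 hU a).const_mul _)
    (memLp_piLp_iff.1 hV j)]
  simp_rw [covariance_const_mul_left]

lemma crossCov_mulVec_right (hU : MemLp U 2 P) (hV : MemLp V 2 P) (D : Matrix m l ℝ) :
    crossCov P U (fun ω => WithLp.toLp 2 (D *ᵥ (V ω).ofLp)) = crossCov P U V * Dᵀ := by
  rw [← crossCov_transpose, crossCov_mulVec_left hV hU, Matrix.transpose_mul, crossCov_transpose]

lemma crossCov_sub_left (hU : MemLp U 2 P) (hU' : MemLp U' 2 P) (hV : MemLp V 2 P) :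
    crossCov P (fun ω => U ω - U' ω) V = crossCov P U V - crossCov P U' V := by
  ext i j
  exact covariance_fun_sub_left (memLp_piLp_iff.1 hU i) (memLp_piLp_iff.1 hU' i)
    (memLp_piLp_iff.1 hV j)

lemma crossCov_sub_right (hU : MemLp U 2 P) (hV : MemLp V 2 P) (hV' : MemLp V' 2 P) :
    crossCov P U (fun ω => V ω - V' ω) = crossCov P U V - crossCov P U V' := by
  rw [← crossCov_transpose, crossCov_sub_left hV hV' hU, Matrix.transpose_sub,
    crossCov_transpose, crossCov_transpose]

omit [Fintype l] in
lemma crossCov_const_add_left (hU : Integrable U P) (c : EuclideanSpace ℝ k) :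
    crossCov P (fun ω => c + U ω) V = crossCov P U V := by
  ext i j
  exact covariance_const_add_left (integrable_piLp_iff.1 hU i) _

omit [Fintype k] in
lemma crossCov_const_add_right (hV : Integrable V P) (c : EuclideanSpace ℝ l) :
    crossCov P U (fun ω => c + V ω) = crossCov P U V := by
  rw [← crossCov_transpose, crossCov_const_add_left hV, crossCov_transpose]

/-- The quadratic form at `x` is the variance of the scalar `x ⬝ U`, written as the image of `U`
under a one-row matrix so that the matrix rules apply. -/
lemma posSemidef_crossCov_self (hU : MemLp U 2 P) : (crossCov P U U).PosSemidef := by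
  refine .of_dotProduct_mulVec_nonneg ?_ fun x => ?_
  · rw [Matrix.IsHermitian, Matrix.conjTranspose_eq_transpose_of_trivial, crossCov_transpose]
  · have h1 := crossCov_mulVec_left hU (hU.toLp_mulVec (Matrix.replicateRow Unit x))
      (Matrix.replicateRow Unit x)
    rw [crossCov_mulVec_right hU hU] at h1
    have h2 : star x ⬝ᵥ crossCov P U U *ᵥ x
        = (Matrix.replicateRow Unit x * (crossCov P U U * (Matrix.replicateRow Unit x)ᵀ)) () () := by
      simp [Matrix.mul_apply, dotProduct, Matrix.mulVec]
    rw [h2, ← h1, crossCov, Matrix.of_apply, covariance_self]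
    · exact variance_nonneg _ _
    · exact (memLp_piLp_iff.1 (hU.toLp_mulVec (Matrix.replicateRow Unit x)) ()).aemeasurable

lemma integral_norm_sq_eq (hU : MemLp U 2 P) :
    ∫ ω, ‖U ω‖ ^ 2 ∂P = ‖∫ ω, U ω ∂P‖ ^ 2 + (crossCov P U U).trace := by
  have hi (i : k) := memLp_piLp_iff.1 hU i
  simp_rw [EuclideanSpace.real_norm_sq_eq]
  rw [integral_finsetSum _ fun i _ => (hi i).integrable_sq, Matrix.trace,
    ← Finset.sum_add_distrib]
  refine Finset.sum_congr rfl fun i _ => ?_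
  rw [eval_integral_piLp fun j => (hi j).integrable one_le_two, Matrix.diag, crossCov,
    Matrix.of_apply, covariance_eq_sub (hi i) (hi i)]
  simp only [Pi.mul_apply, sq]
  ring

lemma trace_crossCov_sub {V : Ω → EuclideanSpace ℝ k} (hU : MemLp U 2 P) (hV : MemLp V 2 P) :
    (crossCov P (fun ω => U ω - V ω) (fun ω => U ω - V ω)).trace =
      (crossCov P U U).trace + (crossCov P V V).trace - 2 * (crossCov P U V).trace := by
  have hUV : MemLp (fun ω => U ω - V ω) 2 P := hU.sub hV
  rw [crossCov_sub_left hU hV hUV, crossCov_sub_right hU hU hV,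
    crossCov_sub_right hV hU hV, ← crossCov_transpose U V]
  simp only [Matrix.trace_sub, Matrix.trace_transpose]
  ring

/-- The second moment of a difference `U - V`. -/
lemma integral_norm_sub_sq_eq {V : Ω → EuclideanSpace ℝ k} (hU : MemLp U 2 P) (hV : MemLp V 2 P) :
    ∫ ω, ‖U ω - V ω‖ ^ 2 ∂P = ‖(∫ ω, U ω ∂P) - ∫ ω, V ω ∂P‖ ^ 2 +
      ((crossCov P U U).trace + (crossCov P V V).trace - 2 * (crossCov P U V).trace) := by
  rw [← trace_crossCov_sub hU hV, ← integral_sub (hU.integrable one_le_two)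
    (hV.integrable one_le_two)]
  exact integral_norm_sq_eq (hU.sub hV)

lemma crossCov_multivariateGaussian [DecidableEq k] {a : EuclideanSpace ℝ k} {A : Matrix k k ℝ}
    (hA : A.PosSemidef) :
    crossCov (multivariateGaussian a A) (fun x => x) (fun x => x) = A := by
  ext i j
  exact covariance_eval_multivariateGaussian hA i j

/-- A Gaussian law on a Euclidean space is determined by its mean and covariance matrix. -/
lemma ProbabilityTheory.HasGaussianLaw.map_eq_multivariateGaussian [DecidableEq k]
    (hU : HasGaussianLaw U P) :
    P.map U = multivariateGaussian (∫ ω, U ω ∂P) (crossCov P U U) := by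
  have hm := hU.isGaussian_map
  apply IsGaussian.ext
  · rw [integral_id_multivariateGaussian', integral_map hU.aemeasurable (by fun_prop)]
    rfl
  · ext x y
    rw [covarianceBilin_multivariateGaussian (posSemidef_crossCov_self hU.memLp_two)]
    have := covarianceBilin_apply_pi (X := fun i ω => U ω i) (memLp_piLp_iff.1 hU.memLp_two) x y
    refine this.trans ?_
    simp only [dotProduct, Matrix.mulVec, crossCov, Matrix.of_apply, Finset.mul_sum]
    exact Finset.sum_congr rfl fun i _ => Finset.sum_congr rfl fun j _ => by ring

end CrossCov

/-! ### Optimal transport between Gaussian measures -/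

section GaussianTransport

variable {n : Type*} [Fintype n] [DecidableEq n]

lemma covTerm_eq (A B : Matrix n n ℝ) : covTerm A B =
    A.trace + B.trace - 2 * (CFC.sqrt (CFC.sqrt A * B * CFC.sqrt A)).trace := by
  rw [covTerm, Matrix.trace_sub, Matrix.trace_add, Matrix.trace_smul, nsmul_eq_mul, Nat.cast_ofNat]

variable {a b : EuclideanSpace ℝ n} {A B : Matrix n n ℝ}

lemma integral_eq_of_map_eq_multivariateGaussian {Ω : Type*} [MeasurableSpace Ω] {P : Measure Ω}
    {U : Ω → EuclideanSpace ℝ n} (hU : AEMeasurable U P)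
    (h : P.map U = multivariateGaussian a A) : ∫ ω, U ω ∂P = a := by
  rw [← integral_id_multivariateGaussian (μ := a) (S := A), ← h,
    integral_map hU (by fun_prop)]

lemma crossCov_eq_of_map_eq_multivariateGaussian {Ω : Type*} [MeasurableSpace Ω] {P : Measure Ω}
    {U : Ω → EuclideanSpace ℝ n} (hU : AEMeasurable U P) (hA : A.PosSemidef)
    (h : P.map U = multivariateGaussian a A) : crossCov P U U = A := by
  rw [← crossCov_multivariateGaussian (a := a) hA, ← h,
    crossCov_map (by fun_prop) (by fun_prop) hU]

lemma memLp_of_map_eq_multivariateGaussian {Ω : Type*} [MeasurableSpace Ω] {P : Measure Ω}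
    {U : Ω → EuclideanSpace ℝ n} (h : P.map U = multivariateGaussian a A) : MemLp U 2 P :=
  HasGaussianLaw.memLp_two ⟨by rw [h]; infer_instance⟩

variable {π : Measure (EuclideanSpace ℝ n × EuclideanSpace ℝ n)}

/-- `transportCosts` ranges over arbitrary measures; the marginal condition alone fixes the total
mass. -/
lemma isProbabilityMeasure_of_map_fst_eq (h₁ : π.map Prod.fst = multivariateGaussian a A) :
    IsProbabilityMeasure π := by
  have : IsProbabilityMeasure (π.map Prod.fst) := by rw [h₁]; infer_instance
  exact Measure.isProbabilityMeasure_of_map Prod.fst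

/-- The marginals fix every term except the cross-covariance, so minimising the cost means
maximising its trace. -/
lemma integral_norm_sub_sq_of_gaussian_marginals (hA : A.PosSemidef) (hB : B.PosSemidef)
    (h₁ : π.map Prod.fst = multivariateGaussian a A)
    (h₂ : π.map Prod.snd = multivariateGaussian b B) :
    ∫ q, ‖q.1 - q.2‖ ^ 2 ∂π = ‖a - b‖ ^ 2 +
      (A.trace + B.trace - 2 * (crossCov π Prod.fst Prod.snd).trace) := by
  have := isProbabilityMeasure_of_map_fst_eq h₁
  rw [integral_norm_sub_sq_eq (memLp_of_map_eq_multivariateGaussian h₁)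
    (memLp_of_map_eq_multivariateGaussian h₂),
    integral_eq_of_map_eq_multivariateGaussian (by fun_prop) h₁,
    integral_eq_of_map_eq_multivariateGaussian (by fun_prop) h₂,
    crossCov_eq_of_map_eq_multivariateGaussian (by fun_prop) hA h₁,
    crossCov_eq_of_map_eq_multivariateGaussian (by fun_prop) hB h₂]

lemma lintegral_enorm_sub_sq_of_gaussian_marginals (hA : A.PosSemidef) (hB : B.PosSemidef)
    (h₁ : π.map Prod.fst = multivariateGaussian a A)
    (h₂ : π.map Prod.snd = multivariateGaussian b B) :
    ∫⁻ q, ‖q.1 - q.2‖ₑ ^ 2 ∂π = ENNReal.ofReal (‖a - b‖ ^ 2 +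
      (A.trace + B.trace - 2 * (crossCov π Prod.fst Prod.snd).trace)) := by
  have := isProbabilityMeasure_of_map_fst_eq h₁
  rw [← integral_norm_sub_sq_of_gaussian_marginals hA hB h₁ h₂]
  exact lintegral_enorm_sq_eq ((memLp_of_map_eq_multivariateGaussian h₁).sub
    (memLp_of_map_eq_multivariateGaussian h₂))

/-- The hypothesis of `Matrix.trace_le_trace_sqrt` holds because the covariance of `P u - Q v` is
positive semidefinite. -/
lemma trace_crossCov_le_of_gaussian_marginals (hA : A.PosSemidef) (hB : B.PosSemidef)
    (h₁ : π.map Prod.fst = multivariateGaussian a A)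
    (h₂ : π.map Prod.snd = multivariateGaussian b B) :
    (crossCov π Prod.fst Prod.snd).trace ≤
      (CFC.sqrt (CFC.sqrt A * B * CFC.sqrt A)).trace := by
  have := isProbabilityMeasure_of_map_fst_eq h₁
  have m₁ := memLp_of_map_eq_multivariateGaussian h₁
  have m₂ := memLp_of_map_eq_multivariateGaussian h₂
  refine Matrix.trace_le_trace_sqrt hA hB fun P Q => ?_
  have h := (posSemidef_crossCov_self ((m₁.toLp_mulVec P).sub (m₂.toLp_mulVec Q))).trace_nonneg
  have h' := trace_crossCov_sub (m₁.toLp_mulVec P) (m₂.toLp_mulVec Q)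
  rw [crossCov_mulVec_left m₁ (m₁.toLp_mulVec P), crossCov_mulVec_left m₁ (m₂.toLp_mulVec Q),
    crossCov_mulVec_left m₂ (m₂.toLp_mulVec Q), crossCov_mulVec_right m₁ m₁,
    crossCov_mulVec_right m₁ m₂, crossCov_mulVec_right m₂ m₂,
    crossCov_eq_of_map_eq_multivariateGaussian (by fun_prop) hA h₁,
    crossCov_eq_of_map_eq_multivariateGaussian (by fun_prop) hB h₂,
    ← mul_assoc, ← mul_assoc, ← mul_assoc] at h'
  have h'' := h.trans_eq h'
  linarith

/-- An affine image of a standard Gaussian vector is Gaussian. -/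
lemma map_stdGaussian_affine (a : EuclideanSpace ℝ n) (D : Matrix n n ℝ) :
    (stdGaussian (EuclideanSpace ℝ n)).map (fun z => a + WithLp.toLp 2 (D *ᵥ z.ofLp)) =
      multivariateGaussian a (D * Dᵀ) := by
  have hz : (stdGaussian (EuclideanSpace ℝ n)).map (fun z => z) = multivariateGaussian 0 1 := by
    simp
  have mz := memLp_of_map_eq_multivariateGaussian hz
  have mD := mz.toLp_mulVec D
  have hl : HasGaussianLaw (fun z : EuclideanSpace ℝ n => a + WithLp.toLp 2 (D *ᵥ z.ofLp))
      (stdGaussian (EuclideanSpace ℝ n)) := by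
    have h0 : IsGaussian ((stdGaussian (EuclideanSpace ℝ n)).map
        (Matrix.toEuclideanCLM (𝕜 := ℝ) D)) := inferInstance
    have h1 : IsGaussian (((stdGaussian (EuclideanSpace ℝ n)).map
        (Matrix.toEuclideanCLM (𝕜 := ℝ) D)).map (fun x => a + x)) := inferInstance
    rw [Measure.map_map (by fun_prop) (by fun_prop)] at h1
    exact ⟨h1⟩
  rw [hl.map_eq_multivariateGaussian, crossCov_const_add_left (mD.integrable one_le_two),
    crossCov_const_add_right (mD.integrable one_le_two), crossCov_mulVec_left mz mD,
    crossCov_mulVec_right mz mz,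
    crossCov_eq_of_map_eq_multivariateGaussian (by fun_prop) Matrix.PosSemidef.one hz, one_mul,
    integral_add (integrable_const _) (mD.integrable one_le_two),
    integral_toLp_mulVec (mz.integrable one_le_two),
    integral_eq_of_map_eq_multivariateGaussian (by fun_prop) hz]
  simp

/-- The optimal coupling of two Gaussian measures. -/
lemma exists_optimal_gaussian_coupling (a b : EuclideanSpace ℝ n)
    (hA : A.PosSemidef) (hB : B.PosSemidef) :
    ∃ π : Measure (EuclideanSpace ℝ n × EuclideanSpace ℝ n),
      π.map Prod.fst = multivariateGaussian a A ∧ π.map Prod.snd = multivariateGaussian b B ∧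
      (crossCov π Prod.fst Prod.snd).trace =
        (CFC.sqrt (CFC.sqrt A * B * CFC.sqrt A)).trace := by
  set S := CFC.sqrt A with hS
  set T := CFC.sqrt B with hT
  have hSt : Sᵀ = S := Matrix.transpose_sqrt A
  have hTt : Tᵀ = T := Matrix.transpose_sqrt B
  have hSS : S * S = A := CFC.sqrt_mul_sqrt_self A hA.nonneg
  have hTT : T * T = B := CFC.sqrt_mul_sqrt_self B hB.nonneg
  obtain ⟨U, hU, hUM⟩ := Matrix.exists_orthogonal_mul_sqrt (T * S)
  have hM : (T * S)ᵀ * (T * S) = S * B * S := by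
    rw [Matrix.transpose_mul, hSt, hTt, ← hTT]
    simp only [mul_assoc]
  rw [hM] at hUM
  have hz : (stdGaussian (EuclideanSpace ℝ n)).map (fun z => z) = multivariateGaussian 0 1 := by
    simp
  have mz := memLp_of_map_eq_multivariateGaussian hz
  -- Orthogonality of `U` leaves the covariance of `g` equal to `T * T = B`, and it aligns the two
  -- vectors: `tr (S Uᵀ T) = tr (Uᵀ T S) = tr (Uᵀ U M) = tr M`.
  let f : EuclideanSpace ℝ n → EuclideanSpace ℝ n := fun z => a + WithLp.toLp 2 (S *ᵥ z.ofLp)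
  let g : EuclideanSpace ℝ n → EuclideanSpace ℝ n :=
    fun z => b + WithLp.toLp 2 ((T * U) *ᵥ z.ofLp)
  have hf : Measurable f := by
    exact (measurable_const_add a).comp (Matrix.toEuclideanCLM (𝕜 := ℝ) S).continuous.measurable
  have hg : Measurable g := by
    exact (measurable_const_add b).comp
      (Matrix.toEuclideanCLM (𝕜 := ℝ) (T * U)).continuous.measurable
  refine ⟨(stdGaussian (EuclideanSpace ℝ n)).map (fun z => (f z, g z)), ?_, ?_, ?_⟩
  · rw [Measure.map_map measurable_fst (hf.prodMk hg)]
    refine (map_stdGaussian_affine a S).trans ?_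
    rw [hSt, hSS]
  · rw [Measure.map_map measurable_snd (hf.prodMk hg)]
    refine (map_stdGaussian_affine b (T * U)).trans ?_
    rw [Matrix.transpose_mul, hTt, mul_assoc, ← mul_assoc U, mul_eq_one_comm.1 hU, one_mul, hTT]
  · rw [crossCov_map (by fun_prop) (by fun_prop) (hf.prodMk hg).aemeasurable]
    have h : crossCov (stdGaussian (EuclideanSpace ℝ n)) f g = S * (T * U)ᵀ := by
      rw [crossCov_const_add_left ((mz.toLp_mulVec S).integrable one_le_two),
        crossCov_const_add_right ((mz.toLp_mulVec (T * U)).integrable one_le_two),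
        crossCov_mulVec_left mz (mz.toLp_mulVec _), crossCov_mulVec_right mz mz,
        crossCov_eq_of_map_eq_multivariateGaussian (by fun_prop) Matrix.PosSemidef.one hz, one_mul]
    refine (congrArg Matrix.trace h).trans ?_
    rw [Matrix.transpose_mul, hTt, Matrix.trace_mul_comm, mul_assoc, ← hUM, ← mul_assoc, hU,
      one_mul]

/-- It is the cost of an optimal coupling of the two centred Gaussians. -/
lemma covTerm_nonneg (hA : A.PosSemidef) (hB : B.PosSemidef) : 0 ≤ covTerm A B := by
  obtain ⟨π, h₁, h₂, h⟩ := exists_optimal_gaussian_coupling 0 0 hA hB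
  have h' := integral_norm_sub_sq_of_gaussian_marginals hA hB h₁ h₂
  rw [h, ← covTerm_eq, sub_self, norm_zero, zero_pow two_ne_zero, zero_add] at h'
  rw [← h']
  positivity

/-- The least transport cost between Gaussian measures is their Fréchet distance. -/
theorem isLeast_transportCosts_multivariateGaussian (a b : EuclideanSpace ℝ n)
    (hA : A.PosSemidef) (hB : B.PosSemidef) :
    IsLeast (transportCosts (multivariateGaussian a A) (multivariateGaussian b B))
      (ENNReal.ofReal (‖a - b‖ ^ 2 + covTerm A B)) := by
  constructor
  · obtain ⟨π, h₁, h₂, h⟩ := exists_optimal_gaussian_coupling a b hA hB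
    refine ⟨π, h₁, h₂, ?_⟩
    rw [lintegral_enorm_sub_sq_of_gaussian_marginals hA hB h₁ h₂, h, covTerm_eq]
  · rintro c ⟨π, h₁, h₂, rfl⟩
    rw [lintegral_enorm_sub_sq_of_gaussian_marginals hA hB h₁ h₂, covTerm_eq]
    have := trace_crossCov_le_of_gaussian_marginals hA hB h₁ h₂
    exact ENNReal.ofReal_le_ofReal (by linarith)

end GaussianTransport

/-! ### Independence and conditional laws -/

/-- If `R` is independent of `X`, the conditional law of `f X + R` given `X = x` is the law of
`f x + R`. -/
lemma ProbabilityTheory.IndepFun.condDistrib_add {Ω F E : Type*} [MeasurableSpace Ω]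
    [MeasurableSpace F] [NormedAddCommGroup E] [MeasurableSpace E] [BorelSpace E]
    [SecondCountableTopology E] [StandardBorelSpace E] {P : Measure Ω} [IsProbabilityMeasure P]
    {X : Ω → F} {R : Ω → E} {f : F → E} (hX : AEMeasurable X P) (hR : AEMeasurable R P)
    (hf : Measurable f) (h : IndepFun X R P) :
    ∀ᵐ x ∂(P.map X), condDistrib (fun ω => f (X ω) + R ω) X P x
      = (P.map R).map (fun r => f x + r) := by
  have := Measure.isProbabilityMeasure_map hX
  have := Measure.isProbabilityMeasure_map hR
  let g : F × E → E := fun q => f q.1 + q.2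
  have hg : Measurable g := by fun_prop
  let κ : Kernel F E := (Kernel.id ×ₖ Kernel.const F (P.map R)).map g
  have hκ (x : F) : κ x = (P.map R).map (fun r => f x + r) := by
    rw [Kernel.map_apply _ hg, Kernel.prod_apply, Kernel.id_apply, Kernel.const_apply,
      Measure.dirac_prod, Measure.map_map hg (by fun_prop)]
    rfl
  have hfX : AEMeasurable (fun ω => f (X ω)) P := hf.comp_aemeasurable hX
  have hκm : IsMarkovKernel κ := Kernel.IsMarkovKernel.map _ hg
  -- Independence makes the law of `(X, R)` a product, so Tonelli disintegrates the joint law along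
  -- `κ`; uniqueness of disintegration then identifies the conditional law.
  have key : P.map (fun ω => (X ω, f (X ω) + R ω)) = P.map X ⊗ₘ κ := by
    refine Measure.ext_of_lintegral _ fun φ hφ => ?_
    rw [Measure.lintegral_compProd hφ, lintegral_map' hφ.aemeasurable (by fun_prop)]
    have h1 (x : F) : ∫⁻ y, φ (x, y) ∂κ x = ∫⁻ r, φ (x, f x + r) ∂(P.map R) := by
      rw [hκ, lintegral_map (by fun_prop) (by fun_prop)]
    simp_rw [h1]
    rw [← lintegral_prod (fun q : F × E => φ (q.1, f q.1 + q.2))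
      (Measurable.aemeasurable (by fun_prop)),
      ← (indepFun_iff_map_prod_eq_prod_map_map hX hR).1 h,
      lintegral_map' (Measurable.aemeasurable (by fun_prop)) (by fun_prop)]
  filter_upwards [condDistrib_ae_eq_of_measure_eq_compProd X (by fun_prop) key] with x hx
  rw [hx, hκ]

lemma ProbabilityTheory.multivariateGaussian_map_const_add {n : Type*} [Fintype n] [DecidableEq n]
    (a c : EuclideanSpace ℝ n) (S : Matrix n n ℝ) :
    (multivariateGaussian a S).map (fun r => c + r) = multivariateGaussian (c + a) S := by
  rw [multivariateGaussian, Measure.map_map (by fun_prop) (by fun_prop), multivariateGaussian]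
  congr 1
  ext1 x
  simp [add_assoc]

/-- Jointly Gaussian vectors with vanishing cross-covariance are independent. -/
lemma ProbabilityTheory.HasGaussianLaw.indepFun_of_crossCov_eq_zero {Ω p n : Type*}
    [MeasurableSpace Ω] {P : Measure Ω} [IsProbabilityMeasure P] [Fintype p] [Fintype n]
    {X : Ω → EuclideanSpace ℝ p} {R : Ω → EuclideanSpace ℝ n}
    (hXR : HasGaussianLaw (fun ω => (X ω, R ω)) P) (h : crossCov P X R = 0) :
    IndepFun X R P := by
  refine hXR.indepFun_of_covariance_inner fun x y => ?_
  have hX := memLp_piLp_iff.1 hXR.fst.memLp_two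
  have hR := memLp_piLp_iff.1 hXR.snd.memLp_two
  simp only [PiLp.inner_apply, RCLike.inner_apply, conj_trivial]
  rw [covariance_fun_sum_fun_sum (fun i => (hX i).mul_const _) (fun i => (hR i).mul_const _)]
  refine Finset.sum_eq_zero fun i _ => Finset.sum_eq_zero fun j _ => ?_
  have hij : covariance (fun ω => X ω i) (fun ω => R ω j) P = 0 := congrFun (congrFun h i) j
  rw [covariance_mul_const_left, covariance_mul_const_right, hij, zero_mul, zero_mul]

/-! ### Conditional means and covariances by linear regression -/

section Conditional

variable {Ω : Type*} [MeasurableSpace Ω] {P : Measure Ω} [IsProbabilityMeasure P]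
  {p n : Type*} [Fintype p] [DecidableEq p] [Fintype n]
  {X : Ω → EuclideanSpace ℝ p} {Y : Ω → EuclideanSpace ℝ n}

omit [IsProbabilityMeasure P] in
lemma condMean_eq (x : EuclideanSpace ℝ p) : condMean P X Y x =
    WithLp.toLp 2 ((crossCov P Y X * (crossCov P X X)⁻¹) *ᵥ x.ofLp) + ((∫ ω, Y ω ∂P) -
      WithLp.toLp 2 ((crossCov P Y X * (crossCov P X X)⁻¹) *ᵥ (∫ ω, X ω ∂P).ofLp)) := by
  rw [condMean, WithLp.ofLp_sub, Matrix.mulVec_sub, WithLp.toLp_sub]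
  abel

/-- The regression matrix `C_yx C_xx⁻¹` is the solution of the normal equations that this identity
expresses. -/
lemma crossCov_residual (hX : MemLp X 2 P) (hY : MemLp Y 2 P) (hC : IsUnit (crossCov P X X).det) :
    crossCov P X (fun ω => Y ω -
      WithLp.toLp 2 ((crossCov P Y X * (crossCov P X X)⁻¹) *ᵥ (X ω).ofLp)) = 0 := by
  rw [crossCov_sub_right hX hY (hX.toLp_mulVec _), crossCov_mulVec_right hX hX,
    Matrix.transpose_mul, Matrix.transpose_nonsing_inv, crossCov_transpose, crossCov_transpose,
    ← Matrix.mul_assoc, Matrix.mul_nonsing_inv _ hC, Matrix.one_mul, sub_self]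

/-- As the residual is uncorrelated with `X`, its covariance with itself equals its covariance with
`Y`. -/
lemma crossCov_residual_self (hX : MemLp X 2 P) (hY : MemLp Y 2 P)
    (hC : IsUnit (crossCov P X X).det) :
    crossCov P
      (fun ω => Y ω - WithLp.toLp 2 ((crossCov P Y X * (crossCov P X X)⁻¹) *ᵥ (X ω).ofLp))
      (fun ω => Y ω - WithLp.toLp 2 ((crossCov P Y X * (crossCov P X X)⁻¹) *ᵥ (X ω).ofLp)) =
    condCov P X Y := by
  have hR : MemLp (fun ω => Y ω -
    WithLp.toLp 2 ((crossCov P Y X * (crossCov P X X)⁻¹) *ᵥ (X ω).ofLp)) 2 P :=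
    hY.sub (hX.toLp_mulVec _)
  rw [crossCov_sub_left hY (hX.toLp_mulVec _) hR, crossCov_mulVec_left hX hR,
    crossCov_residual hX hY hC, Matrix.mul_zero, sub_zero, crossCov_sub_right hY hY (hX.toLp_mulVec _),
    crossCov_mulVec_right hY hX, Matrix.transpose_mul, Matrix.transpose_nonsing_inv,
    crossCov_transpose, crossCov_transpose, condCov, Matrix.mul_assoc]

lemma posSemidef_condCov (hX : MemLp X 2 P) (hY : MemLp Y 2 P)
    (hC : IsUnit (crossCov P X X).det) : (condCov P X Y).PosSemidef := by
  rw [← crossCov_residual_self hX hY hC]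
  exact posSemidef_crossCov_self (hY.sub (hX.toLp_mulVec _))

/-- The conditional law of `Y` given `X`, when `(X, Y)` is jointly Gaussian. -/
theorem condDistrib_ae_eq_multivariateGaussian [DecidableEq n]
    (hXY : HasGaussianLaw (fun ω => (X ω, Y ω)) P) (hC : IsUnit (crossCov P X X).det) :
    ∀ᵐ x ∂(P.map X), condDistrib Y X P x =
      multivariateGaussian (condMean P X Y x) (condCov P X Y) := by
  have hX := hXY.fst.memLp_two
  have hY := hXY.snd.memLp_two
  set B := crossCov P Y X * (crossCov P X X)⁻¹ with hB
  let L : EuclideanSpace ℝ p →L[ℝ] EuclideanSpace ℝ n :=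
    (Matrix.toLpLin 2 2 B).toContinuousLinearMap
  let R : Ω → EuclideanSpace ℝ n := fun ω => Y ω - WithLp.toLp 2 (B *ᵥ (X ω).ofLp)
  -- `(X, R)` is a continuous linear image of `(X, Y)`; joint Gaussianity is what upgrades zero
  -- correlation to independence.
  have hXR : HasGaussianLaw (fun ω => (X ω, R ω)) P :=
    hXY.map_fun ((ContinuousLinearMap.fst ℝ _ _).prod
      (ContinuousLinearMap.snd ℝ _ _ - L ∘L ContinuousLinearMap.fst ℝ _ _))
  have hind := hXR.indepFun_of_crossCov_eq_zero (crossCov_residual hX hY hC)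
  have hlaw : P.map R = multivariateGaussian
      ((∫ ω, Y ω ∂P) - WithLp.toLp 2 (B *ᵥ (∫ ω, X ω ∂P).ofLp)) (condCov P X Y) := by
    rw [hXR.snd.map_eq_multivariateGaussian]
    congr 1
    · rw [integral_sub (hY.integrable one_le_two) ((hX.toLp_mulVec B).integrable one_le_two),
        integral_toLp_mulVec (hX.integrable one_le_two)]
    · exact crossCov_residual_self hX hY hC
  have hdec : (fun ω => L (X ω) + R ω) = Y := by
    ext1 ω
    exact add_sub_cancel _ _
  have h := hind.condDistrib_add hXY.fst.aemeasurable hXR.snd.aemeasurable L.continuous.measurable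
  rw [hdec, hlaw] at h
  filter_upwards [h] with x hx
  rw [hx, multivariateGaussian_map_const_add, condMean_eq]
  rfl

variable {Yh : Ω → EuclideanSpace ℝ n}

omit [IsProbabilityMeasure P] in
lemma condMean_sub_condMean (x : EuclideanSpace ℝ p) :
    condMean P X Y x - condMean P X Yh x =
      (((∫ ω, Y ω ∂P) - ∫ ω, Yh ω ∂P) -
        WithLp.toLp 2 (((crossCov P Y X - crossCov P Yh X) * (crossCov P X X)⁻¹) *ᵥ
          (∫ ω, X ω ∂P).ofLp)) +
      WithLp.toLp 2 (((crossCov P Y X - crossCov P Yh X) * (crossCov P X X)⁻¹) *ᵥ x.ofLp) := by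
  simp only [condMean_eq, Matrix.sub_mul, Matrix.sub_mulVec, WithLp.toLp_sub]
  abel

lemma memLp_condMean_sub_condMean (hX : MemLp X 2 P) :
    MemLp (fun x => condMean P X Y x - condMean P X Yh x) 2 (P.map X) := by
  have := Measure.isProbabilityMeasure_map hX.aemeasurable
  have hi : MemLp (fun x : EuclideanSpace ℝ p => x) 2 (P.map X) :=
    (memLp_map_measure_iff (by fun_prop) hX.aemeasurable).2 hX
  rw [funext condMean_sub_condMean]
  exact (memLp_const (((∫ ω, Y ω ∂P) - ∫ ω, Yh ω ∂P) -
    WithLp.toLp 2 (((crossCov P Y X - crossCov P Yh X) * (crossCov P X X)⁻¹) *ᵥ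
      (∫ ω, X ω ∂P).ofLp))).add (hi.toLp_mulVec _)

/-- With `D = (C_yx - C_ŷx) C_xx⁻¹`, the difference is a constant plus `D x`. At `x = m_x` it equals
`m_y - m_ŷ`, and its covariance `D C_xx Dᵀ` collapses to `D (C_xy - C_xŷ)`. -/
lemma integral_norm_condMean_sub_condMean_sq (hX : MemLp X 2 P)
    (hC : IsUnit (crossCov P X X).det) :
    ∫ x, ‖condMean P X Y x - condMean P X Yh x‖ ^ 2 ∂(P.map X) =
      ‖(∫ ω, Y ω ∂P) - ∫ ω, Yh ω ∂P‖ ^ 2 +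
        ((crossCov P Y X - crossCov P Yh X) * (crossCov P X X)⁻¹
          * (crossCov P X Y - crossCov P X Yh)).trace := by
  have := Measure.isProbabilityMeasure_map hX.aemeasurable
  have hi : MemLp (fun x : EuclideanSpace ℝ p => x) 2 (P.map X) :=
    (memLp_map_measure_iff (by fun_prop) hX.aemeasurable).2 hX
  have hmean : ∫ x, x ∂(P.map X) = ∫ ω, X ω ∂P := integral_map hX.aemeasurable (by fun_prop)
  rw [integral_norm_sq_eq (memLp_condMean_sub_condMean hX)]
  simp_rw [condMean_sub_condMean]
  set D := (crossCov P Y X - crossCov P Yh X) * (crossCov P X X)⁻¹ with hD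
  have hDi := hi.toLp_mulVec D
  rw [crossCov_const_add_left (hDi.integrable one_le_two),
    crossCov_const_add_right (hDi.integrable one_le_two), crossCov_mulVec_left hi hDi,
    crossCov_mulVec_right hi hi, crossCov_map (by fun_prop) (by fun_prop) hX.aemeasurable,
    integral_add (integrable_const _) (hDi.integrable one_le_two),
    integral_toLp_mulVec (hi.integrable one_le_two),
    hmean, integral_const]
  have h1 : D * (crossCov P X X * Dᵀ) = D * (crossCov P X Y - crossCov P X Yh) := by
    rw [hD, Matrix.transpose_mul, Matrix.transpose_nonsing_inv, Matrix.transpose_sub,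
      crossCov_transpose, crossCov_transpose, crossCov_transpose, ← Matrix.mul_assoc (crossCov P X X),
      Matrix.mul_nonsing_inv _ hC, Matrix.one_mul]
  rw [h1]
  simp

end Conditional

/-! ### The conditional Fréchet distance -/

section CFID

variable {Ω : Type*} [MeasurableSpace Ω] {P : Measure Ω} [IsProbabilityMeasure P]
  {p n : Type*} [Fintype p] [DecidableEq p] [Fintype n]
  {X : Ω → EuclideanSpace ℝ p} {Y Yh : Ω → EuclideanSpace ℝ n}

/-- The constant `c` stands for the trace term, which does not vary with `x`. -/
lemma integrable_frechetDist_condDistrib (hX : MemLp X 2 P) (c : ℝ) :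
    Integrable (fun x => ‖condMean P X Y x - condMean P X Yh x‖ ^ 2 + c) (P.map X) := by
  have := Measure.isProbabilityMeasure_map hX.aemeasurable
  exact ((memLp_condMean_sub_condMean hX).integrable_norm_pow two_ne_zero).add
    (integrable_const _)

lemma integral_frechetDist_condDistrib (hXm : MemLp X 2 P) (hX : IsUnit (crossCov P X X).det)
    (c : ℝ) :
    ∫ x, (‖condMean P X Y x - condMean P X Yh x‖ ^ 2 + c) ∂(P.map X) =
      ‖(∫ ω, Y ω ∂P) - ∫ ω, Yh ω ∂P‖ ^ 2
        + ((crossCov P Y X - crossCov P Yh X) * (crossCov P X X)⁻¹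
            * (crossCov P X Y - crossCov P X Yh)).trace + c := by
  have := Measure.isProbabilityMeasure_map hXm.aemeasurable
  rw [integral_add ((memLp_condMean_sub_condMean hXm).integrable_norm_pow two_ne_zero)
    (integrable_const _), integral_norm_condMean_sub_condMean_sq hXm hX]
  simp

variable [DecidableEq n]

lemma isLeast_transportCosts_condDistrib
    (hXY : HasGaussianLaw (fun ω => (X ω, Y ω)) P)
    (hXYh : HasGaussianLaw (fun ω => (X ω, Yh ω)) P)
    (hX : IsUnit (crossCov P X X).det) :
    ∀ᵐ x ∂(P.map X), IsLeast (transportCosts (condDistrib Y X P x) (condDistrib Yh X P x))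
        (ENNReal.ofReal (‖condMean P X Y x - condMean P X Yh x‖ ^ 2
            + covTerm (condCov P X Y) (condCov P X Yh))) := by
  filter_upwards [condDistrib_ae_eq_multivariateGaussian hXY hX,
    condDistrib_ae_eq_multivariateGaussian hXYh hX] with x h₁ h₂
  rw [h₁, h₂]
  exact isLeast_transportCosts_multivariateGaussian _ _
    (posSemidef_condCov hXY.fst.memLp_two hXY.snd.memLp_two hX)
    (posSemidef_condCov hXYh.fst.memLp_two hXYh.snd.memLp_two hX)

lemma cfid_eq_ofReal_integral
    (hXY : HasGaussianLaw (fun ω => (X ω, Y ω)) P)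
    (hXYh : HasGaussianLaw (fun ω => (X ω, Yh ω)) P)
    (hX : IsUnit (crossCov P X X).det) :
    cfid P X Y Yh = ENNReal.ofReal (∫ x, (‖condMean P X Y x - condMean P X Yh x‖ ^ 2
        + covTerm (condCov P X Y) (condCov P X Yh)) ∂(P.map X)) := by
  have hc := covTerm_nonneg (posSemidef_condCov hXY.fst.memLp_two hXY.snd.memLp_two hX)
    (posSemidef_condCov hXYh.fst.memLp_two hXYh.snd.memLp_two hX)
  rw [ofReal_integral_eq_lintegral_ofReal
    (integrable_frechetDist_condDistrib hXY.fst.memLp_two _)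
    (Filter.Eventually.of_forall fun x => by positivity), cfid]
  refine lintegral_congr_ae ?_
  filter_upwards [isLeast_transportCosts_condDistrib hXY hXYh hX] with x hx
  exact hx.csInf_eq

end CFID

theorem lemma2 {Ω : Type*} [MeasurableSpace Ω] (P : Measure Ω) [IsProbabilityMeasure P]
    {p n : Type*} [Fintype p] [DecidableEq p] [Fintype n] [DecidableEq n]
    (X : Ω → EuclideanSpace ℝ p) (Y Yh : Ω → EuclideanSpace ℝ n)
    (hXY : HasGaussianLaw (fun ω => (X ω, Y ω)) P)
    (hXYh : HasGaussianLaw (fun ω => (X ω, Yh ω)) P)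
    (hX : IsUnit (crossCov P X X).det) :
    -- the conditional laws are Gaussian, and the Wasserstein minimum between them is attained
    -- and equal to the Fréchet distance of these Gaussians
    (∀ᵐ x ∂(P.map X),
      condDistrib Y X P x = multivariateGaussian (condMean P X Y x) (condCov P X Y) ∧
      condDistrib Yh X P x = multivariateGaussian (condMean P X Yh x) (condCov P X Yh) ∧
      0 ≤ ‖condMean P X Y x - condMean P X Yh x‖ ^ 2
            + covTerm (condCov P X Y) (condCov P X Yh) ∧
      IsLeast (transportCosts (condDistrib Y X P x) (condDistrib Yh X P x))
        (ENNReal.ofReal (‖condMean P X Y x - condMean P X Yh x‖ ^ 2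
            + covTerm (condCov P X Y) (condCov P X Yh)))) ∧
    (condCov P X Y).PosSemidef ∧ (condCov P X Yh).PosSemidef ∧
    -- the expectation over `x`
    cfid P X Y Yh ≠ ∞ ∧
    Integrable (fun x => ‖condMean P X Y x - condMean P X Yh x‖ ^ 2
        + covTerm (condCov P X Y) (condCov P X Yh)) (P.map X) ∧
    (cfid P X Y Yh).toReal = ∫ x, (‖condMean P X Y x - condMean P X Yh x‖ ^ 2
        + covTerm (condCov P X Y) (condCov P X Yh)) ∂(P.map X) ∧
    -- the closed form
    (cfid P X Y Yh).toReal =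
      ‖(∫ ω, Y ω ∂P) - ∫ ω, Yh ω ∂P‖ ^ 2
        + ((crossCov P Y X - crossCov P Yh X) * (crossCov P X X)⁻¹
            * (crossCov P X Y - crossCov P X Yh)).trace
        + covTerm (condCov P X Y) (condCov P X Yh) ∧
    -- dependence on first and second moments only
    (∀ {Ω' : Type*} [MeasurableSpace Ω'] (P' : Measure Ω') [IsProbabilityMeasure P']
      (X' : Ω' → EuclideanSpace ℝ p) (Y' Yh' : Ω' → EuclideanSpace ℝ n),
      HasGaussianLaw (fun ω => (X' ω, Y' ω)) P' →
      HasGaussianLaw (fun ω => (X' ω, Yh' ω)) P' →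
      ∫ ω, Y' ω ∂P' = ∫ ω, Y ω ∂P → ∫ ω, Yh' ω ∂P' = ∫ ω, Yh ω ∂P →
      crossCov P' X' X' = crossCov P X X →
      crossCov P' Y' X' = crossCov P Y X → crossCov P' Yh' X' = crossCov P Yh X →
      crossCov P' Y' Y' = crossCov P Y Y → crossCov P' Yh' Yh' = crossCov P Yh Yh →
      cfid P' X' Y' Yh' = cfid P X Y Yh) := by
  have mX := hXY.fst.memLp_two
  have hA := posSemidef_condCov mX hXY.snd.memLp_two hX
  have hB := posSemidef_condCov mX hXYh.snd.memLp_two hX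
  have hc := covTerm_nonneg hA hB
  have hcfid := cfid_eq_ofReal_integral hXY hXYh hX
  have hreal : (cfid P X Y Yh).toReal = ∫ x, (‖condMean P X Y x - condMean P X Yh x‖ ^ 2
      + covTerm (condCov P X Y) (condCov P X Yh)) ∂(P.map X) := by
    rw [hcfid, ENNReal.toReal_ofReal (integral_nonneg fun x => by positivity)]
  refine ⟨?_, hA, hB, ?_, integrable_frechetDist_condDistrib mX _, hreal, ?_, ?_⟩
  · filter_upwards [condDistrib_ae_eq_multivariateGaussian hXY hX,
      condDistrib_ae_eq_multivariateGaussian hXYh hX,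
      isLeast_transportCosts_condDistrib hXY hXYh hX] with x h₁ h₂ h₃
    exact ⟨h₁, h₂, by positivity, h₃⟩
  · rw [hcfid]
    exact ENNReal.ofReal_ne_top
  · rw [hreal, integral_frechetDist_condDistrib mX hX]
  · intro Ω' _ P' _ X' Y' Yh' hXY' hXYh' e₁ e₂ e₃ e₄ e₅ e₆ e₇
    have hX' : IsUnit (crossCov P' X' X').det := by rwa [e₃]
    -- The closed form also involves `C_xy` and `C_xŷ`, which are the transposes of the prescribed
    -- matrices.
    have e₈ : crossCov P' X' Y' = crossCov P X Y := by
      rw [← crossCov_transpose, e₄, crossCov_transpose]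
    have e₉ : crossCov P' X' Yh' = crossCov P X Yh := by
      rw [← crossCov_transpose, e₅, crossCov_transpose]
    rw [hcfid, cfid_eq_ofReal_integral hXY' hXYh' hX',
      integral_frechetDist_condDistrib hXY'.fst.memLp_two hX',
      integral_frechetDist_condDistrib mX hX, condCov, condCov, condCov, condCov,
      e₁, e₂, e₃, e₄, e₅, e₆, e₇, e₈, e₉]
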